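/- For $t>\sqrt2$ there is exactly one real number $\beta=\beta(t)$ with $$1=\int_0^t \frac{u e^{-\beta u}}{1+e^{-\beta u}}\,du ,$$ and it satisfies $\beta(t)<\frac{\pi}{2\sqrt3}$. The function $\beta:(\sqrt2,\infty)\to\left(-\infty,\frac{\pi}{2\sqrt3}\right)$ so defined is differentiable with $\beta'(t)>0$. For $t>0$ and an integer $n\ge 0$ let $d_t(n)$ be the number of partitions of $n$ into distinct parts all of which are at most $t\sqrt n$ (equivalently, the coefficient of $x^n$ in $\prod_{1\le k\le t\sqrt n}(1+x^k)$). Let $\{\alpha\}=\alpha-\lfloor\alpha\rfloor$ denote the fractional part of $\alpha$, and for $t>\sqrt2$, with $\beta=\beta(t)$, put $$B(t)=2\beta+t\log\left(1+e^{-\beta t}\right),\qquad A_n(t)=\frac{e^{\beta t/2}+e^{-\beta t/2}}{2\left(1+e^{-\beta t}\right)^{\{t\sqrt n\}}}\sqrt{\frac{\beta'(t)}{\pi t}} .$$ Then for every fixed $t>\sqrt2$, as $n\to\infty$, $$d_t(n)\sim \frac{A_n(t)}{n^{3/4}}\,e^{B(t)\sqrt n},$$ that is, the ratio of the two sides tends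 to $1$. -/

import Mathlib

/-- The number `d_t(n)` of partitions of `n` into distinct parts, all of them at most `t √n`. -/
noncomputable def distinctCount (t : ℝ) (n : ℕ) : ℕ :=
  Nat.card {p : n.Partition // p.parts.Nodup ∧ ∀ k ∈ p.parts, (k : ℝ) ≤ t * √(n : ℝ)}

/-- The equation `1 = ∫₀ᵗ u e^{-bu} / (1 + e^{-bu}) du` that determines `b = β(t)`. -/
def IsBeta (t b : ℝ) : Prop :=
  1 = ∫ u in (0 : ℝ)..t, u * Real.exp (-b * u) / (1 + Real.exp (-b * u))

open Classical in
/-- The implicit function `β`: the solution `b` of `IsBeta t b`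
(and `0` for those `t` for which there is no solution). -/
noncomputable def beta (t : ℝ) : ℝ :=
  if h : ∃ b, IsBeta t b then h.choose else 0

/-- `B(t) = 2β + t log(1 + e^{-βt})`. -/
noncomputable def Bfun (t : ℝ) : ℝ :=
  2 * beta t + t * Real.log (1 + Real.exp (-beta t * t))

/-- `A_n(t)`; the exponent of the oscillating factor is the fractional part of `t √n`. -/
noncomputable def Afun (n : ℕ) (t : ℝ) : ℝ :=
  (Real.exp (beta t * t / 2) + Real.exp (-(beta t * t / 2))) /
      (2 * (1 + Real.exp (-beta t * t)) ^ Int.fract (t * √(n : ℝ))) *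
    √(deriv beta t / (Real.pi * t))

/-
Put `b = β(t)` and let `ξ_k`, for `1 ≤ k ≤ t √n`, be independent Bernoulli variables of parameter
`1 / (1 + e^{bk/√n})`. Then `d_t(n) e^{-b√n} / ∏ (1 + e^{-bk/√n})` is the probability that
`∑ k ξ_k = n`. The equation for `β(t)` says that the mean of this sum is `n + O(√n)`, while its
variance is `∼ v n^{3/2}` with `v = ∫₀ᵗ u² e^{-bu} / (1 + e^{-bu})² du`, so a local limit theorem
shows that the probability is `∼ (2πv)^{-1/2} n^{-3/4}`. Evaluating the logarithm of the product by
the Euler–Maclaurin formula up to `o(1)` produces the fractional part in `A_n(t)`, and implicit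
differentiation gives `β'(t) = t / ((1 + e^{bt}) v)`.
-/

section DistinctPartitions

open Real MeasureTheory Filter Topology intervalIntegral

attribute [local fun_prop] continuous_sigmoid

/-! ### The function `β` and its derivative -/

theorem exp_div_one_add_exp (x : ℝ) : exp x / (1 + exp x) = sigmoid x := by
  rw [sigmoid_def, exp_neg]
  field_simp
  ring

theorem sigmoid_mul_one_sub_pos (x : ℝ) : 0 < sigmoid x * (1 - sigmoid x) :=
  mul_pos (sigmoid_pos x) (sub_pos.2 (sigmoid_lt_one x))

theorem hasDerivAt_sigmoid_neg_mul (c v : ℝ) :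
    HasDerivAt (fun v => sigmoid (-(c * v)))
      (-(c * (sigmoid (-(c * v)) * (1 - sigmoid (-(c * v)))))) v := by
  have h : HasDerivAt (fun v : ℝ => -(c * v)) (-c) v := by
    simpa using! ((hasDerivAt_id v).const_mul c).neg
  exact ((hasDerivAt_sigmoid _).comp v h).congr_deriv (by ring)

/-- The normalised mean `∫₀¹ v / (1 + e^{cv}) dv`: at `c = βt`, the defining equation of `β` says
that it equals `1 / t²`. -/
noncomputable def logisticMean (c : ℝ) : ℝ := ∫ v in (0 : ℝ)..1, v * sigmoid (-(c * v))

/-- The normalised variance `∫₀¹ v² e^{cv} / (1 + e^{cv})² dv`; it is minus the derivative of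
`logisticMean`, and governs both `β'` and the width of the limiting Gaussian. -/
noncomputable def logisticVariance (c : ℝ) : ℝ :=
  ∫ v in (0 : ℝ)..1, v ^ 2 * (sigmoid (-(c * v)) * (1 - sigmoid (-(c * v))))

theorem intervalIntegrable_mul_sigmoid (c a b : ℝ) :
    IntervalIntegrable (fun v : ℝ => v * sigmoid (-(c * v))) volume a b :=
  Continuous.intervalIntegrable (by fun_prop) _ _

theorem intervalIntegrable_sq_mul_sigmoid (c a b : ℝ) :
    IntervalIntegrable (fun v : ℝ => v ^ 2 * (sigmoid (-(c * v)) * (1 - sigmoid (-(c * v)))))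
      volume a b :=
  Continuous.intervalIntegrable (by fun_prop) _ _

theorem integral_mul_sigmoid (b t : ℝ) :
    ∫ u in (0 : ℝ)..t, u * sigmoid (-(b * u)) = t ^ 2 * logisticMean (b * t) := by
  have h := mul_integral_comp_mul_left (a := 0) (b := 1) (f := fun u => u * sigmoid (-(b * u))) t
  rw [mul_zero, mul_one] at h
  simp only [← h, logisticMean, sq, mul_assoc, intervalIntegral.integral_const_mul]

theorem integral_sq_mul_sigmoid (b t : ℝ) :
    ∫ u in (0 : ℝ)..t, u ^ 2 * (sigmoid (-(b * u)) * (1 - sigmoid (-(b * u)))) =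
      t ^ 3 * logisticVariance (b * t) := by
  have h := mul_integral_comp_mul_left (a := 0) (b := 1)
    (f := fun u => u ^ 2 * (sigmoid (-(b * u)) * (1 - sigmoid (-(b * u))))) t
  rw [mul_zero, mul_one] at h
  simp only [← h, logisticVariance, pow_succ' t 2, mul_pow, mul_assoc,
    intervalIntegral.integral_const_mul]

theorem logisticVariance_pos (c : ℝ) : 0 < logisticVariance c :=
  intervalIntegral_pos_of_pos_on (intervalIntegrable_sq_mul_sigmoid c 0 1)
    (fun _ hv => mul_pos (pow_pos hv.1 2) (sigmoid_mul_one_sub_pos _)) one_pos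

theorem continuous_logisticVariance : Continuous logisticVariance := by
  refine continuous_parametric_intervalIntegral_of_continuous'
    (f := fun c v : ℝ => v ^ 2 * (sigmoid (-(c * v)) * (1 - sigmoid (-(c * v))))) ?_ 0 1
  unfold Function.uncurry
  fun_prop

theorem hasDerivAt_logisticMean (c : ℝ) : HasDerivAt logisticMean (-logisticVariance c) c := by
  rw [logisticVariance, ← intervalIntegral.integral_neg]
  refine (hasDerivAt_integral_of_dominated_loc_of_deriv_le
    (F := fun c v : ℝ => v * sigmoid (-(c * v)))
    (F' := fun c v : ℝ => -(v ^ 2 * (sigmoid (-(c * v)) * (1 - sigmoid (-(c * v))))))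
    (bound := fun _ => 1) univ_mem
    (Eventually.of_forall fun x => Continuous.aestronglyMeasurable (by fun_prop))
    (intervalIntegrable_mul_sigmoid c 0 1) (Continuous.aestronglyMeasurable (by fun_prop))
    (ae_of_all _ fun v hv x _ => ?_) (by simp) (ae_of_all _ fun v _ x _ => ?_)).2
  · rw [Set.uIoc_of_le zero_le_one] at hv
    have h := sigmoid_mul_one_sub_pos (-(x * v))
    rw [norm_neg, Real.norm_of_nonneg (mul_nonneg (sq_nonneg v) h.le)]
    exact mul_le_one₀ (pow_le_one₀ hv.1.le hv.2) h.le
      (by nlinarith [sigmoid_pos (-(x * v)), sigmoid_lt_one (-(x * v))])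
  · have h := (hasDerivAt_sigmoid_neg_mul v x).const_mul v
    convert! h using 1
    · simp only [mul_comm v]
    · ring_nf

theorem hasStrictDerivAt_logisticMean (c : ℝ) :
    HasStrictDerivAt logisticMean (-logisticVariance c) c :=
  hasStrictDerivAt_of_hasDerivAt_of_continuousAt (f' := fun c => -logisticVariance c)
    (Eventually.of_forall hasDerivAt_logisticMean) continuous_logisticVariance.neg.continuousAt

theorem logisticMean_strictAnti : StrictAnti logisticMean :=
  strictAnti_of_hasDerivAt_neg hasDerivAt_logisticMean fun c =>
    neg_neg_of_pos (logisticVariance_pos c)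

theorem logisticMean_neg (c : ℝ) : logisticMean (-c) = 1 / 2 - logisticMean c := by
  have h : ∀ v : ℝ, v * sigmoid (-(-c * v)) = v - v * sigmoid (-(c * v)) := fun v => by
    rw [neg_mul, sigmoid_neg (-(c * v))]
    ring
  simp only [logisticMean, h]
  rw [integral_sub intervalIntegrable_id (intervalIntegrable_mul_sigmoid c 0 1), integral_id]
  norm_num

theorem logisticMean_le_one_div {c : ℝ} (hc : 0 < c) : logisticMean c ≤ 1 / c := by
  have h : ∀ v ∈ Set.Icc (0 : ℝ) 1, v * sigmoid (-(c * v)) ≤ 1 / c := fun v _ => by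
    rw [sigmoid_def, neg_neg, ← div_eq_mul_inv, div_le_div_iff₀ (by positivity) hc]
    linarith [add_one_le_exp (c * v)]
  simpa using! integral_mono_on zero_le_one (intervalIntegrable_mul_sigmoid c 0 1)
    (intervalIntegrable_const (c := 1 / c)) h

theorem Ioo_subset_range_logisticMean : Set.Ioo 0 (1 / 2) ⊆ Set.range logisticMean := by
  rintro y ⟨h0, h1⟩
  have hcont : Continuous logisticMean :=
    continuous_iff_continuousAt.2 fun c => (hasDerivAt_logisticMean c).continuousAt
  have hle : logisticMean (1 / y) ≤ y := by
    simpa using! logisticMean_le_one_div (one_div_pos.2 h0)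
  have hge : y ≤ logisticMean (-(1 / (1 / 2 - y))) := by
    have h := logisticMean_le_one_div (one_div_pos.2 (sub_pos.2 h1))
    rw [one_div_one_div] at h
    linarith [logisticMean_neg (1 / (1 / 2 - y))]
  exact mem_range_of_exists_le_of_exists_ge hcont ⟨_, hle⟩ ⟨_, hge⟩

-- Integrate the derivative of `v² / (1 + e^{cv})` over `[0, 1]`.
theorem two_mul_logisticMean_sub (c : ℝ) :
    2 * logisticMean c - c * logisticVariance c = sigmoid (-c) := by
  have hd : ∀ v ∈ Set.uIcc (0 : ℝ) 1, HasDerivAt (fun v : ℝ => v ^ 2 * sigmoid (-(c * v)))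
      (2 * (v * sigmoid (-(c * v)))
        - c * (v ^ 2 * (sigmoid (-(c * v)) * (1 - sigmoid (-(c * v)))))) v := fun v _ =>
    ((hasDerivAt_pow 2 v).mul (hasDerivAt_sigmoid_neg_mul c v)).congr_deriv (by simp; ring)
  have hM := (intervalIntegrable_mul_sigmoid c 0 1).const_mul 2
  have hV := (intervalIntegrable_sq_mul_sigmoid c 0 1).const_mul c
  have h := integral_eq_sub_of_hasDerivAt hd (hM.sub hV)
  rw [integral_sub hM hV, intervalIntegral.integral_const_mul,
    intervalIntegral.integral_const_mul] at h
  simpa [logisticMean, logisticVariance] using! h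

theorem pos_of_sqrt_two_lt {t : ℝ} (ht : √2 < t) : 0 < t := (sqrt_nonneg 2).trans_lt ht

theorem isBeta_iff {t : ℝ} (ht : 0 < t) (b : ℝ) :
    IsBeta t b ↔ logisticMean (b * t) = 1 / t ^ 2 := by
  simp only [IsBeta, mul_div_assoc, exp_div_one_add_exp, neg_mul, integral_mul_sigmoid]
  rw [eq_div_iff (by positivity), eq_comm, mul_comm]

theorem isBeta_beta {t : ℝ} (ht : √2 < t) : IsBeta t (beta t) := by
  have h0 := pos_of_sqrt_two_lt ht
  have hmem : 1 / t ^ 2 ∈ Set.Ioo (0 : ℝ) (1 / 2) :=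
    ⟨by positivity, one_div_lt_one_div_of_lt two_pos ((sqrt_lt' h0).1 ht)⟩
  obtain ⟨c, hc⟩ := Ioo_subset_range_logisticMean hmem
  have hex : ∃ b, IsBeta t b := ⟨c / t, by rwa [isBeta_iff h0, div_mul_cancel₀ _ h0.ne']⟩
  rw [beta, dif_pos hex]
  exact hex.choose_spec

theorem logisticMean_beta {t : ℝ} (ht : √2 < t) : logisticMean (beta t * t) = 1 / t ^ 2 :=
  (isBeta_iff (pos_of_sqrt_two_lt ht) _).1 (isBeta_beta ht)

theorem eq_beta_of_isBeta {t b : ℝ} (ht : √2 < t) (hb : IsBeta t b) : b = beta t := by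
  have h0 := pos_of_sqrt_two_lt ht
  rw [isBeta_iff h0, ← logisticMean_beta ht] at hb
  exact mul_right_cancel₀ h0.ne' (logisticMean_strictAnti.injective hb)

theorem hasDerivAt_beta_mul_self {t : ℝ} (ht : √2 < t) :
    HasDerivAt (fun s => beta s * s) (2 / (t ^ 3 * logisticVariance (beta t * t))) t := by
  have h0 := pos_of_sqrt_two_lt ht
  have hV := logisticVariance_pos (beta t * t)
  have hM := hasStrictDerivAt_logisticMean (beta t * t)
  obtain ⟨g, hg, hMg⟩ : ∃ g : ℝ → ℝ, HasDerivAt g (-logisticVariance (beta t * t))⁻¹ (1 / t ^ 2) ∧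
      ∀ᶠ y in 𝓝 (1 / t ^ 2), logisticMean (g y) = y := by
    rw [← logisticMean_beta ht]
    exact ⟨_, (hM.to_localInverse (neg_ne_zero.2 hV.ne')).hasDerivAt,
      hM.eventually_right_inverse (neg_ne_zero.2 hV.ne')⟩
  have hsq : HasDerivAt (fun s : ℝ => 1 / s ^ 2) (-2 / t ^ 3) t := by
    simp only [one_div]
    exact ((hasDerivAt_pow 2 t).inv (by positivity)).congr_deriv (by field)
  have hloc : (fun s => beta s * s) =ᶠ[𝓝 t] g ∘ fun s => 1 / s ^ 2 := by
    filter_upwards [hsq.continuousAt.eventually hMg, lt_mem_nhds ht] with s hs hs'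
    rw [← logisticMean_beta hs'] at hs
    exact (logisticMean_strictAnti.injective (by simpa [logisticMean_beta hs'] using hs)).symm
  exact ((hg.comp t hsq).congr_of_eventuallyEq hloc).congr_deriv (by field)

theorem hasDerivAt_beta {t : ℝ} (ht : √2 < t) :
    HasDerivAt beta (sigmoid (-(beta t * t)) / (t ^ 2 * logisticVariance (beta t * t))) t := by
  have h0 := pos_of_sqrt_two_lt ht
  have hV := logisticVariance_pos (beta t * t)
  have hparts := two_mul_logisticMean_sub (beta t * t)
  rw [logisticMean_beta ht] at hparts
  have hloc : beta =ᶠ[𝓝 t] fun s => beta s * s / s := by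
    filter_upwards [lt_mem_nhds h0] with s hs
    rw [mul_div_cancel_right₀ _ hs.ne']
  refine (((hasDerivAt_beta_mul_self ht).div (hasDerivAt_id t) h0.ne').congr_of_eventuallyEq
    hloc).congr_deriv ?_
  simp only [id, ← hparts]
  field

theorem deriv_beta {t : ℝ} (ht : √2 < t) :
    deriv beta t = sigmoid (-(beta t * t)) / (t ^ 2 * logisticVariance (beta t * t)) :=
  (hasDerivAt_beta ht).deriv

theorem deriv_beta_pos {t : ℝ} (ht : √2 < t) : 0 < deriv beta t := by
  rw [deriv_beta ht]
  have := pos_of_sqrt_two_lt ht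
  exact div_pos (sigmoid_pos _) (mul_pos (by positivity) (logisticVariance_pos _))

/-! ### The bound `β < π / (2√3)` -/

theorem hasSum_neg_one_pow_div_sq :
    HasSum (fun n : ℕ => (-1 : ℝ) ^ n * (1 / ((n : ℝ) + 1) ^ 2)) (π ^ 2 / 12) := by
  have hB : ((Polynomial.bernoulli 2).map (algebraMap ℚ ℝ)).eval (1 / 2 : ℝ) = -1 / 12 := by
    simp only [Polynomial.bernoulli, Finset.sum_range_succ]
    norm_num [bernoulli, bernoulli', Nat.choose]
  have h := hasSum_one_div_nat_pow_mul_cos one_ne_zero (x := 1 / 2) ⟨by norm_num, by norm_num⟩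
  rw [mul_one, hB, ← hasSum_nat_add_iff' 1] at h
  convert! h.neg using 1
  · ext n
    rw [show 2 * π * ((n + 1 : ℕ) : ℝ) * (1 / 2) = (n + 1 : ℕ) * π by ring, cos_nat_mul_pi]
    push_cast
    ring
  · norm_num [Nat.factorial]
    ring

theorem integral_mul_exp_neg_mul_Ioi {r : ℝ} (hr : 0 < r) :
    ∫ u in Set.Ioi (0 : ℝ), u * exp (-(r * u)) = 1 / r ^ 2 := by
  have h := integral_rpow_mul_exp_neg_mul_Ioi (a := 2) two_pos hr
  norm_num at h ⊢
  exact h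

theorem integrableOn_mul_exp_neg_mul_Ioi {r : ℝ} (hr : 0 < r) :
    IntegrableOn (fun u : ℝ => u * exp (-(r * u))) (Set.Ioi 0) :=
  .of_integral_ne_zero (by rw [integral_mul_exp_neg_mul_Ioi hr]; positivity)

theorem hasSum_mul_sigmoid_neg {u : ℝ} (hu : 0 < u) :
    HasSum (fun k : ℕ => (-1) ^ k * (u * exp (-((k + 1 : ℝ) * u)))) (u * sigmoid (-u)) := by
  have h := (hasSum_geometric_of_abs_lt_one (r := -exp (-u))
    (by rw [abs_neg, abs_exp]; exact exp_lt_one_iff.2 (neg_neg_of_pos hu))).mul_left (u * exp (-u))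
  rw [sub_neg_eq_add, ← div_eq_mul_inv, mul_div_assoc, exp_div_one_add_exp] at h
  refine h.congr_fun fun k => ?_
  rw [neg_pow (exp (-u)), ← exp_nat_mul, add_one_mul, neg_add, exp_add, mul_neg]
  ring

theorem integral_mul_sigmoid_neg_Ioi :
    ∫ u in Set.Ioi (0 : ℝ), u * sigmoid (-u) = π ^ 2 / 12 := by
  have hint : ∀ k : ℕ, ∫ u in Set.Ioi (0 : ℝ), (-1) ^ k * (u * exp (-((k + 1 : ℝ) * u))) =
      (-1) ^ k * (1 / ((k : ℝ) + 1) ^ 2) := fun k => by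
    rw [MeasureTheory.integral_const_mul, integral_mul_exp_neg_mul_Ioi k.cast_add_one_pos]
  have hnorm : ∀ k : ℕ, ∫ u in Set.Ioi (0 : ℝ), ‖(-1) ^ k * (u * exp (-((k + 1 : ℝ) * u)))‖ =
      1 / ((k : ℝ) + 1) ^ 2 := fun k => by
    rw [← integral_mul_exp_neg_mul_Ioi k.cast_add_one_pos]
    refine setIntegral_congr_fun measurableSet_Ioi fun u hu => ?_
    simp [abs_of_pos (Set.mem_Ioi.1 hu)]
  have h := hasSum_integral_of_summable_integral_norm
    (fun k : ℕ => (integrableOn_mul_exp_neg_mul_Ioi k.cast_add_one_pos).const_mul ((-1) ^ k))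
    (by simpa only [hnorm, Nat.cast_add_one] using
      (summable_nat_add_iff 1).2 (summable_one_div_nat_pow.2 one_lt_two))
  simp only [hint] at h
  rw [← h.unique hasSum_neg_one_pow_div_sq]
  exact setIntegral_congr_fun measurableSet_Ioi fun u hu => (hasSum_mul_sigmoid_neg hu).tsum_eq.symm

theorem logisticMean_lt {c : ℝ} (hc : 0 < c) : logisticMean c < π ^ 2 / (12 * c ^ 2) := by
  have hint : IntegrableOn (fun u : ℝ => u * sigmoid (-u)) (Set.Ioi 0) :=
    .of_integral_ne_zero (by rw [integral_mul_sigmoid_neg_Ioi]; positivity)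
  have htail : 0 < ∫ u in Set.Ioi c, u * sigmoid (-u) := by
    have hpos : ∀ u ∈ Set.Ioi c, 0 < u * sigmoid (-u) := fun u hu =>
      mul_pos (hc.trans hu) (sigmoid_pos _)
    rw [setIntegral_pos_iff_support_of_nonneg_ae
      (ae_restrict_of_forall_mem measurableSet_Ioi fun u hu => (hpos u hu).le)
      (hint.mono_set (Set.Ioi_subset_Ioi hc.le)),
      Set.inter_eq_right.2 fun u hu => Function.mem_support.2 (hpos u hu).ne', volume_Ioi]
    exact ENNReal.zero_lt_top
  have hsplit := integral_interval_add_Ioi hint (hint.mono_set (Set.Ioi_subset_Ioi hc.le))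
  have hhead := integral_mul_sigmoid 1 c
  simp only [one_mul] at hhead
  rw [hhead, integral_mul_sigmoid_neg_Ioi] at hsplit
  rw [lt_div_iff₀ (by positivity)]
  linarith

theorem beta_lt {t : ℝ} (ht : √2 < t) : beta t < π / (2 * √3) := by
  have h0 := pos_of_sqrt_two_lt ht
  rcases le_or_gt (beta t) 0 with hb | hb
  · exact hb.trans_lt (by positivity)
  · have h := logisticMean_lt (mul_pos hb h0)
    rw [logisticMean_beta ht, mul_pow, ← mul_assoc, ← div_div, div_lt_div_iff_of_pos_right
      (by positivity), lt_div_iff₀ (by positivity), one_mul] at h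
    rw [lt_div_iff₀ (by positivity)]
    refine lt_of_pow_lt_pow_left₀ 2 pi_pos.le ?_
    rw [mul_pow, mul_pow, sq_sqrt zero_le_three]
    linarith

/-! ### Euler–Maclaurin summation -/

theorem abs_iteratedDerivWithin_two_Icc_le {f : ℝ → ℝ} (hf : ContDiff ℝ 2 f) {a b C : ℝ}
    (hab : a < b) (hC : ∀ x ∈ Set.Icc a b, |iteratedDeriv 2 f x| ≤ C) (x : ℝ) :
    |iteratedDerivWithin 2 f (Set.Icc a b) x| ≤ C := by
  by_cases hx : x ∈ Set.Icc a b
  · rw [iteratedDerivWithin_eq_iteratedDeriv (uniqueDiffOn_Icc hab) hf.contDiffAt hx]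
    exact hC x hx
  · rw [iteratedDerivWithin_succ,
      derivWithin_zero_of_notMem_closure (by rwa [isClosed_Icc.closure_eq]), abs_zero]
    exact (abs_nonneg _).trans (hC a (Set.left_mem_Icc.2 hab.le))

theorem abs_sum_sub_integral_sub_le {f : ℝ → ℝ} (hf : ContDiff ℝ 2 f) {m C : ℝ} (hm : 0 < m)
    {N : ℕ} (hC : ∀ x ∈ Set.Icc 0 (N / m), |iteratedDeriv 2 f x| ≤ C) :
    |∑ k ∈ Finset.Icc 1 N, f (k / m) - m * (∫ x in (0 : ℝ)..N / m, f x) - (f (N / m) - f 0) / 2| ≤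
      N * C / (12 * m ^ 2) := by
  rcases N.eq_zero_or_pos with rfl | hN
  · simp
  have hN' : (0 : ℝ) < N := Nat.cast_pos.2 hN
  have hsum : ∑ k ∈ Finset.Icc 1 N, f (k / m) =
      ∑ k ∈ Finset.range (N - 1), f (0 + (k + 1) * (N / m - 0) / N) + f (N / m) := by
    obtain ⟨M, rfl⟩ := Nat.exists_eq_add_of_le' hN
    rw [Finset.sum_Icc_succ_top (by omega), Nat.add_sub_cancel, Finset.range_eq_Ico,
      ← Finset.Ico_add_one_right_eq_Icc, ← Finset.sum_Ico_add' _ 0 M 1]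
    congr 1
    refine Finset.sum_congr rfl fun k _ => congrArg f ?_
    push_cast
    field
  have htrap := trapezoidal_error_le_of_c2 hf.contDiffOn (a := 0) (b := N / m) (ζ := C) (fun x => by
    rw [Set.uIcc_of_le (by positivity)]
    exact abs_iteratedDerivWithin_two_Icc_le hf (by positivity) hC x) hN
  calc _ = |m * trapezoidal_error f N 0 (N / m)| := by
        rw [trapezoidal_error, trapezoidal_integral, hsum]
        congr 1
        field
    _ ≤ m * (|N / m - 0| ^ 3 * C / (12 * N ^ 2)) := by
        rw [abs_mul, abs_of_pos hm]
        gcongr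
    _ = N * C / (12 * m ^ 2) := by
        rw [sub_zero, abs_of_pos (by positivity)]
        field

theorem mul_floor_div_sub {t m : ℝ} (ht : 0 ≤ t) (hm : 0 < m) :
    m * ((⌊t * m⌋₊ : ℝ) / m - t) = -Int.fract (t * m) := by
  rw [← Int.self_sub_floor, ← natCast_floor_eq_intCast_floor (by positivity)]
  field

theorem abs_fract_le_one (x : ℝ) : |Int.fract x| ≤ 1 := by
  rw [abs_of_nonneg (Int.fract_nonneg x)]
  exact (Int.fract_lt_one x).le

theorem tendsto_mul_integral_floor_sub {f : ℝ → ℝ} (hf : Continuous f) {t : ℝ} (ht : 0 ≤ t) :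
    Tendsto (fun m : ℝ => m * ((∫ x in (0 : ℝ)..⌊t * m⌋₊ / m, f x) - ∫ x in (0 : ℝ)..t, f x) +
      Int.fract (t * m) * f t) atTop (𝓝 0) := by
  have ho := (hf.integral_hasStrictDerivAt 0 t).hasDerivAt.isLittleO.comp_tendsto
    (tendsto_nat_floor_mul_div_atTop ht)
  have hO : (fun m : ℝ => m * ((⌊t * m⌋₊ : ℝ) / m - t)) =O[atTop] fun _ => (1 : ℝ) := by
    refine Asymptotics.IsBigO.of_bound 1 ?_
    filter_upwards [eventually_gt_atTop 0] with m hm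
    simpa [mul_floor_div_sub ht hm] using abs_fract_le_one (t * m)
  have h := (Asymptotics.isLittleO_one_iff ℝ).1
    (((Asymptotics.isBigO_refl (fun m : ℝ => m) atTop).mul_isLittleO ho).trans_isBigO hO)
  refine h.congr' ?_
  filter_upwards [eventually_gt_atTop 0] with m hm
  simp only [Function.comp_apply, smul_eq_mul]
  linear_combination (-f t) * mul_floor_div_sub ht hm

-- Euler–Maclaurin at step `1 / m`; the fractional part accounts for the gap between `t` and the
-- last grid point.
theorem tendsto_sum_sub_integral {f : ℝ → ℝ} (hf : ContDiff ℝ 2 f) {t : ℝ} (ht : 0 ≤ t) :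
    Tendsto (fun m : ℝ => ∑ k ∈ Finset.Icc 1 ⌊t * m⌋₊, f (k / m) -
      (m * (∫ x in (0 : ℝ)..t, f x) - Int.fract (t * m) * f t + (f t - f 0) / 2))
      atTop (𝓝 0) := by
  have hend := tendsto_nat_floor_mul_div_atTop (R := ℝ) ht
  obtain ⟨C, hC⟩ := isCompact_Icc.exists_bound_of_continuousOn (s := Set.Icc 0 t)
    (hf.continuous_iteratedDeriv 2 le_rfl).continuousOn
  have htrap : Tendsto (fun m : ℝ => ∑ k ∈ Finset.Icc 1 ⌊t * m⌋₊, f (k / m) -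
      m * (∫ x in (0 : ℝ)..⌊t * m⌋₊ / m, f x) - (f (⌊t * m⌋₊ / m) - f 0) / 2) atTop (𝓝 0) := by
    have hlim : Tendsto (fun m : ℝ => (⌊t * m⌋₊ : ℝ) / m * (C / (12 * m))) atTop (𝓝 0) := by
      simpa using! hend.mul ((tendsto_const_nhds (x := C)).div_atTop
        (tendsto_id.const_mul_atTop (by norm_num : (0 : ℝ) < 12)))
    refine squeeze_zero_norm' ?_ hlim
    filter_upwards [eventually_gt_atTop 0] with m hm
    have hle : (⌊t * m⌋₊ : ℝ) / m ≤ t := (div_le_iff₀ hm).2 (Nat.floor_le (by positivity))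
    refine (abs_sum_sub_integral_sub_le hf hm fun x hx =>
      hC x ⟨hx.1, hx.2.trans hle⟩).trans_eq ?_
    field
  have hval : Tendsto (fun m : ℝ => (f (⌊t * m⌋₊ / m) - f t) / 2) atTop (𝓝 0) := by
    simpa using! (((hf.continuous.tendsto t).comp hend).sub_const (f t)).div_const 2
  refine (((htrap.add (tendsto_mul_integral_floor_sub hf.continuous ht)).add hval).congr
    fun m => ?_).trans (by simp)
  ring

theorem isBigO_sum_sub_integral {f : ℝ → ℝ} (hf : ContDiff ℝ 2 f) {t : ℝ} (ht : 0 ≤ t) :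
    (fun m : ℝ => ∑ k ∈ Finset.Icc 1 ⌊t * m⌋₊, f (k / m) - m * ∫ x in (0 : ℝ)..t, f x)
      =O[atTop] fun _ => (1 : ℝ) := by
  have hfract : (fun m : ℝ => Int.fract (t * m) * f t) =O[atTop] fun _ => (1 : ℝ) :=
    .of_bound |f t| (Eventually.of_forall fun m => by
      simpa using mul_le_mul_of_nonneg_right (abs_fract_le_one (t * m)) (abs_nonneg (f t)))
  have hconst : (fun _ : ℝ => (f t - f 0) / 2) =O[atTop] fun _ => (1 : ℝ) :=
    Asymptotics.isBigO_const_const _ one_ne_zero _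
  refine ((((tendsto_sum_sub_integral hf ht).isBigO_one ℝ).sub hfract).add hconst).congr_left
    fun m => ?_
  ring

theorem tendsto_sum_sub_integral_div {f : ℝ → ℝ} (hf : ContDiff ℝ 2 f) {t : ℝ} (ht : 0 ≤ t)
    {w : ℝ → ℝ} (hw : Tendsto w atTop atTop) :
    Tendsto (fun m : ℝ =>
      (∑ k ∈ Finset.Icc 1 ⌊t * m⌋₊, f (k / m) - m * ∫ x in (0 : ℝ)..t, f x) / w m) atTop (𝓝 0) := by
  have h := (isBigO_sum_sub_integral hf ht).mul_isLittleO
    ((Asymptotics.isLittleO_one_iff ℝ).2 hw.inv_tendsto_atTop)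
  simp only [mul_one] at h
  exact (Asymptotics.isLittleO_one_iff ℝ).1 h

theorem tendsto_sum_div {f : ℝ → ℝ} (hf : ContDiff ℝ 2 f) {t : ℝ} (ht : 0 ≤ t) :
    Tendsto (fun m : ℝ => (∑ k ∈ Finset.Icc 1 ⌊t * m⌋₊, f (k / m)) / m) atTop
      (𝓝 (∫ x in (0 : ℝ)..t, f x)) := by
  have h := (tendsto_sum_sub_integral_div hf ht tendsto_id).add_const (∫ x in (0 : ℝ)..t, f x)
  rw [zero_add] at h
  refine h.congr' ?_
  filter_upwards [eventually_gt_atTop 0] with m hm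
  simp only [id]
  field

/-! ### Fourier inversion -/

theorem distinctCount_eq_card {t : ℝ} (ht : 0 ≤ t) (n : ℕ) :
    distinctCount t n =
      {S ∈ (Finset.Icc 1 ⌊t * √(n : ℝ)⌋₊).powerset | ∑ k ∈ S, k = n}.card := by
  have hle (k : ℕ) : (k : ℝ) ≤ t * √(n : ℝ) ↔ k ≤ ⌊t * √(n : ℝ)⌋₊ :=
    (Nat.le_floor_iff (by positivity)).symm
  have hmem (S : Finset ℕ) :
      S ∈ {S ∈ (Finset.Icc 1 ⌊t * √(n : ℝ)⌋₊).powerset | ∑ k ∈ S, k = n} ↔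
        (∀ k ∈ S.val, 0 < k) ∧ S.val.sum = n ∧ ∀ k ∈ S.val, (k : ℝ) ≤ t * √(n : ℝ) := by
    simp only [Finset.mem_filter, Finset.mem_powerset, Finset.subset_iff, Finset.mem_Icc,
      Finset.sum_eq_multiset_sum, Multiset.map_id', hle, Finset.mem_val]
    grind
  rw [distinctCount, ← Nat.card_eq_finsetCard]
  exact Nat.card_congr
    { toFun := fun p => ⟨⟨p.1.parts, p.2.1⟩,
        (hmem _).2 ⟨fun _ => p.1.parts_pos, p.1.parts_sum, p.2.2⟩⟩
      invFun := fun S => ⟨⟨S.1.val, fun {k} => ((hmem _).1 S.2).1 k, ((hmem _).1 S.2).2.1⟩,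
        S.1.nodup, ((hmem _).1 S.2).2.2⟩
      left_inv := fun _ => rfl
      right_inv := fun _ => rfl }

theorem prod_one_add_pow {R : Type*} [CommSemiring R] (s : Finset ℕ) (z : R) :
    ∏ k ∈ s, (1 + z ^ k) = ∑ S ∈ s.powerset, z ^ ∑ k ∈ S, k := by
  rw [Finset.prod_one_add]
  exact Finset.sum_congr rfl fun S _ => Finset.prod_pow_eq_pow_sum S (fun k => k) z

theorem integral_exp_int_mul (j : ℤ) :
    ∫ θ in -π..π, Complex.exp (j * θ * Complex.I) = if j = 0 then (2 * π : ℂ) else 0 := by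
  split_ifs with h
  · simp [h, two_mul]
  · have hperiod : (j : ℂ) * Complex.I * π =
        j * Complex.I * (-π : ℝ) + j * (2 * π * Complex.I) := by
      push_cast
      ring
    have hc : (j : ℂ) * Complex.I ≠ 0 := mul_ne_zero (by exact_mod_cast h) Complex.I_ne_zero
    simp only [mul_right_comm _ _ Complex.I]
    rw [integral_exp_mul_complex hc, hperiod, Complex.exp_add, Complex.exp_int_mul_two_pi_mul_I,
      mul_one, sub_self, zero_div]

theorem integral_sum_pow_mul_exp {ι : Type*} (s : Finset ι) (d : ι → ℕ) (x : ℂ) (n : ℕ) :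
    ∫ θ in -π..π, (∑ i ∈ s, (x * Complex.exp (θ * Complex.I)) ^ d i) *
        Complex.exp (-(n * θ) * Complex.I) =
      2 * π * ({i ∈ s | d i = n}.card * x ^ n) := by
  have hexp (θ : ℝ) : (∑ i ∈ s, (x * Complex.exp (θ * Complex.I)) ^ d i) *
      Complex.exp (-(n * θ) * Complex.I) =
        ∑ i ∈ s, x ^ d i * Complex.exp (((d i - n : ℤ) : ℂ) * θ * Complex.I) := by
    rw [Finset.sum_mul]
    refine Finset.sum_congr rfl fun i _ => ?_
    rw [mul_pow, ← Complex.exp_nat_mul, mul_assoc, ← Complex.exp_add]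
    push_cast
    ring_nf
  simp only [hexp]
  rw [intervalIntegral.integral_finsetSum fun i _ =>
    Continuous.intervalIntegrable (by fun_prop) _ _]
  simp only [intervalIntegral.integral_const_mul, integral_exp_int_mul, sub_eq_zero, Nat.cast_inj,
    mul_ite, mul_zero]
  rw [← Finset.sum_filter, Finset.sum_congr rfl fun i hi => by rw [(Finset.mem_filter.1 hi).2],
    Finset.sum_const, nsmul_eq_mul]
  ring

/-- The characteristic function at `α` of a Bernoulli variable of parameter `p`. -/
noncomputable def bernoulliChar (p α : ℝ) : ℂ := 1 - p + p * Complex.exp (α * Complex.I)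

/-- The product `∏ (1 + e^{-bk/m})` over `1 ≤ k ≤ t m`: at `m = √n`, the generating function of the
partitions that `distinctCount` counts, evaluated at `e^{-b/√n}`. -/
noncomputable def partitionProd (b t m : ℝ) : ℝ :=
  ∏ k ∈ Finset.Icc 1 ⌊t * m⌋₊, (1 + exp (-(b * (k / m))))

/-- The characteristic function at `θ` of `∑ k ξ_k`, where `ξ_k` for `1 ≤ k ≤ t m` are independent
Bernoulli variables of parameter `1 / (1 + e^{bk/m})`. -/
noncomputable def charProd (b t m θ : ℝ) : ℂ :=
  ∏ k ∈ Finset.Icc 1 ⌊t * m⌋₊, bernoulliChar (sigmoid (-(b * (k / m)))) (k * θ)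

theorem one_add_exp_mul_exp_eq (x α : ℝ) :
    1 + (exp x : ℂ) * Complex.exp (α * Complex.I) =
      (1 + exp x : ℝ) * bernoulliChar (sigmoid x) α := by
  have h : (1 + exp x) * sigmoid x = exp x := by
    rw [← exp_div_one_add_exp]
    field
  have hC : ((1 + exp x : ℝ) : ℂ) * sigmoid x = exp x := by exact_mod_cast h
  rw [bernoulliChar]
  push_cast at hC ⊢
  linear_combination (1 - Complex.exp (α * Complex.I)) * hC

theorem prod_one_add_pow_eq_partitionProd_mul (b t m θ : ℝ) :
    ∏ k ∈ Finset.Icc 1 ⌊t * m⌋₊, (1 + ((exp (-(b / m)) : ℂ) * Complex.exp (θ * Complex.I)) ^ k) =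
      partitionProd b t m * charProd b t m θ := by
  rw [partitionProd, charProd, Complex.ofReal_prod, ← Finset.prod_mul_distrib]
  refine Finset.prod_congr rfl fun k _ => ?_
  have hk : exp (-(b / m)) ^ k = exp (-(b * (k / m))) := by
    rw [← exp_nat_mul]
    ring_nf
  rw [← one_add_exp_mul_exp_eq, ← hk, mul_pow, ← Complex.exp_nat_mul]
  push_cast
  ring_nf

theorem distinctCount_mul_exp_eq {t : ℝ} (ht : 0 ≤ t) (b : ℝ) {n : ℕ} (hn : n ≠ 0) :
    2 * π * ((distinctCount t n : ℂ) * exp (-(b * √(n : ℝ)))) =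
      partitionProd b t √(n : ℝ) *
        ∫ θ in -π..π, charProd b t √(n : ℝ) θ * Complex.exp (-(n * θ) * Complex.I) := by
  have : (0 : ℝ) < √(n : ℝ) := sqrt_pos.2 (by exact_mod_cast Nat.pos_of_ne_zero hn)
  have hn' : (exp (-(b / √(n : ℝ))) : ℂ) ^ n = exp (-(b * √(n : ℝ))) := by
    rw [← Complex.ofReal_pow, ← exp_nat_mul]
    congr 2
    nth_rw 1 [← mul_self_sqrt (Nat.cast_nonneg n)]
    field
  rw [distinctCount_eq_card ht, ← hn', ← integral_sum_pow_mul_exp,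
    ← intervalIntegral.integral_const_mul]
  simp only [← prod_one_add_pow, prod_one_add_pow_eq_partitionProd_mul, mul_assoc]

theorem distinctCount_eq_re_integral {t : ℝ} (ht : 0 ≤ t) (b : ℝ) {n : ℕ} (hn : n ≠ 0) :
    (distinctCount t n : ℝ) = exp (b * √(n : ℝ)) * partitionProd b t √(n : ℝ) / (2 * π) *
      (∫ θ in -π..π, charProd b t √(n : ℝ) θ * Complex.exp (-(n * θ) * Complex.I)).re := by
  have h : 2 * π * (distinctCount t n * exp (-(b * √(n : ℝ)))) = partitionProd b t √(n : ℝ) *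
      (∫ θ in -π..π, charProd b t √(n : ℝ) θ * Complex.exp (-(n * θ) * Complex.I)).re := by
    rw [← Complex.re_ofReal_mul, ← distinctCount_mul_exp_eq ht b hn]
    norm_cast
  rw [mul_div_assoc, mul_assoc, div_mul_eq_mul_div, ← h, exp_neg]
  field

/-! ### Gaussian limit of the characteristic function -/

theorem norm_bernoulliChar_le (p α : ℝ) :
    ‖bernoulliChar p α‖ ≤ exp (-(p * (1 - p) * (1 - cos α))) := by
  refine le_of_sq_le_sq ?_ (exp_pos _).le
  have hre : (bernoulliChar p α).re = 1 - p + p * cos α := by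
    simp [bernoulliChar, Complex.exp_ofReal_mul_I_re]
  have him : (bernoulliChar p α).im = p * sin α := by
    simp [bernoulliChar, Complex.exp_ofReal_mul_I_im]
  calc ‖bernoulliChar p α‖ ^ 2 = 2 * -(p * (1 - p) * (1 - cos α)) + 1 := by
        rw [← Complex.normSq_eq_norm_sq, Complex.normSq_apply, hre, him]
        linear_combination p ^ 2 * sin_sq_add_cos_sq α
    _ ≤ exp (2 * -(p * (1 - p) * (1 - cos α))) := add_one_le_exp _
    _ = exp (-(p * (1 - p) * (1 - cos α))) ^ 2 := by
        rw [two_mul, exp_add, sq]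

theorem norm_bernoulliChar_le_one {p : ℝ} (hp : p ∈ Set.Icc 0 1) (α : ℝ) :
    ‖bernoulliChar p α‖ ≤ 1 :=
  (norm_bernoulliChar_le p α).trans <| exp_le_one_iff.2 <| neg_nonpos.2 <|
    mul_nonneg (mul_nonneg hp.1 (sub_nonneg.2 hp.2)) (sub_nonneg.2 (cos_le_one α))

theorem norm_prod_sub_prod_le_sum {ι R : Type*} [NormedCommRing R] [NormOneClass R]
    (s : Finset ι) (f g : ι → R) (hf : ∀ i ∈ s, ‖f i‖ ≤ 1) (hg : ∀ i ∈ s, ‖g i‖ ≤ 1) :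
    ‖∏ i ∈ s, f i - ∏ i ∈ s, g i‖ ≤ ∑ i ∈ s, ‖f i - g i‖ := by
  induction s using Finset.cons_induction with
  | empty => simp
  | cons i s hi ih =>
    simp only [Finset.forall_mem_cons] at hf hg
    have hprod : ‖∏ j ∈ s, g j‖ ≤ 1 :=
      (Finset.norm_prod_le s g).trans (Finset.prod_le_one (fun _ _ => norm_nonneg _) hg.2)
    rw [Finset.prod_cons, Finset.prod_cons, Finset.sum_cons]
    calc _ = ‖f i * (∏ j ∈ s, f j - ∏ j ∈ s, g j) + (f i - g i) * ∏ j ∈ s, g j‖ := by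
          congr 1
          ring
      _ ≤ ‖f i‖ * ‖∏ j ∈ s, f j - ∏ j ∈ s, g j‖ + ‖f i - g i‖ * ‖∏ j ∈ s, g j‖ :=
          norm_add_le_of_le (norm_mul_le _ _) (norm_mul_le _ _)
      _ ≤ 1 * ∑ j ∈ s, ‖f j - g j‖ + ‖f i - g i‖ * 1 := by
          gcongr
          · exact hf.1
          · exact ih hf.2 hg.2
      _ = _ := by ring

theorem norm_exp_mul_I_sub_taylor_le {x : ℝ} (hx : |x| ≤ 1) :
    ‖Complex.exp (x * Complex.I) - (1 + x * Complex.I - x ^ 2 / 2)‖ ≤ |x| ^ 3 := by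
  have hn : ‖(x : ℂ) * Complex.I‖ = |x| := by simp
  have h := Complex.exp_bound (x := x * Complex.I) (by rwa [hn]) (n := 3) (by norm_num)
  have hs : ∑ m ∈ Finset.range 3, ((x : ℂ) * Complex.I) ^ m / (m.factorial : ℂ) =
      1 + x * Complex.I - x ^ 2 / 2 := by
    simp [Finset.sum_range_succ, mul_pow, Nat.factorial]
    ring
  rw [hs, hn] at h
  refine h.trans (mul_le_of_le_one_right (by positivity) ?_)
  norm_num [Nat.factorial]

/-- The characteristic function at `α` of a centered Bernoulli variable of parameter `p`. -/
noncomputable def centeredChar (p α : ℝ) : ℂ :=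
  (1 - p) * Complex.exp ((-p * α : ℝ) * Complex.I) +
    p * Complex.exp (((1 - p) * α : ℝ) * Complex.I)

theorem bernoulliChar_eq (p α : ℝ) :
    bernoulliChar p α = Complex.exp ((p * α : ℝ) * Complex.I) * centeredChar p α := by
  have h0 : ((p * α : ℝ) : ℂ) * Complex.I + (-p * α : ℝ) * Complex.I = 0 := by
    push_cast
    ring
  have h1 : ((p * α : ℝ) : ℂ) * Complex.I + ((1 - p) * α : ℝ) * Complex.I = α * Complex.I := by
    push_cast
    ring
  rw [centeredChar, mul_add, mul_left_comm, ← Complex.exp_add, mul_left_comm, ← Complex.exp_add,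
    h0, h1, Complex.exp_zero, mul_one, bernoulliChar]

theorem norm_centeredChar_le_one {p : ℝ} (hp : p ∈ Set.Icc 0 1) (α : ℝ) :
    ‖centeredChar p α‖ ≤ 1 := by
  have h := norm_bernoulliChar_le_one hp α
  rwa [bernoulliChar_eq, norm_mul, Complex.norm_exp_ofReal_mul_I, one_mul] at h

theorem norm_centeredChar_sub_le {p α : ℝ} (hp : p ∈ Set.Icc 0 1) (hα : |α| ≤ 1) :
    ‖centeredChar p α - (1 - p * (1 - p) * α ^ 2 / 2 : ℝ)‖ ≤ |α| ^ 3 := by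
  have hq : 0 ≤ 1 - p := sub_nonneg.2 hp.2
  have htaylor {q : ℝ} (hq : |q| ≤ 1) :
      ‖Complex.exp ((q * α : ℝ) * Complex.I) -
        (1 + (q * α : ℝ) * Complex.I - ((q * α : ℝ) : ℂ) ^ 2 / 2)‖ ≤ |α| ^ 3 := by
    have hle : |q * α| ≤ |α| := by
      rw [abs_mul]
      exact mul_le_of_le_one_left (abs_nonneg _) hq
    exact (norm_exp_mul_I_sub_taylor_le (hle.trans hα)).trans (by gcongr)
  have h0 := htaylor (q := -p) (by rw [abs_neg, abs_of_nonneg hp.1]; exact hp.2)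
  have h1 := htaylor (q := 1 - p) (by rw [abs_of_nonneg hq]; linarith [hp.1])
  set E₀ := Complex.exp ((-p * α : ℝ) * Complex.I)
  set E₁ := Complex.exp (((1 - p) * α : ℝ) * Complex.I)
  calc _ = ‖((1 - p : ℝ) : ℂ) * (E₀ - (1 + (-p * α : ℝ) * Complex.I -
          ((-p * α : ℝ) : ℂ) ^ 2 / 2)) + (p : ℂ) * (E₁ - (1 + ((1 - p) * α : ℝ) * Complex.I -
          (((1 - p) * α : ℝ) : ℂ) ^ 2 / 2))‖ := by
        have hE : centeredChar p α = (1 - p) * E₀ + p * E₁ := rfl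
        rw [hE]
        congr 1
        push_cast
        ring
    _ ≤ (1 - p) * |α| ^ 3 + p * |α| ^ 3 := by
        refine norm_add_le_of_le ?_ ?_
        · rw [norm_mul, Complex.norm_of_nonneg hq]
          gcongr
        · rw [norm_mul, Complex.norm_of_nonneg hp.1]
          gcongr
          exact hp.1
    _ = |α| ^ 3 := by ring

theorem norm_centeredChar_sub_gaussian_le {p α : ℝ} (hp : p ∈ Set.Icc 0 1) (hα : |α| ≤ 1) :
    ‖centeredChar p α - (exp (-(p * (1 - p) * α ^ 2 / 2)) : ℝ)‖ ≤ 2 * |α| ^ 3 := by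
  set s := p * (1 - p) * α ^ 2 / 2 with hs
  have hvar : 0 ≤ p * (1 - p) ∧ p * (1 - p) ≤ 1 := by
    constructor <;> nlinarith [hp.1, hp.2]
  have hsα : s ≤ α ^ 2 := by nlinarith [sq_nonneg α]
  have hs0 : 0 ≤ s := by have := hvar.1; positivity
  have hα2 : α ^ 2 ≤ 1 := (sq_le_one_iff_abs_le_one α).2 hα
  have hexp : ‖((1 - s : ℝ) : ℂ) - (exp (-s) : ℝ)‖ ≤ |α| ^ 3 := by
    rw [← Complex.ofReal_sub, Complex.norm_real, Real.norm_eq_abs]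
    calc |1 - s - exp (-s)| = |exp (-s) - 1 - -s| := by rw [← abs_neg]; congr 1; ring
      _ ≤ (-s) ^ 2 := abs_exp_sub_one_sub_id_le (by rw [abs_neg, abs_of_nonneg hs0]; linarith)
      _ = s ^ 2 := neg_sq s
      _ ≤ (α ^ 2) ^ 2 := by gcongr
      _ = |α| ^ 3 * |α| := by rw [← sq_abs α]; ring
      _ ≤ |α| ^ 3 := mul_le_of_le_one_right (by positivity) hα
  calc _ ≤ |α| ^ 3 + |α| ^ 3 :=
        norm_sub_le_norm_sub_add_norm_sub _ _ _ |>.trans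
          (add_le_add (norm_centeredChar_sub_le hp hα) hexp)
    _ = 2 * |α| ^ 3 := by ring

-- Lyapunov's argument: each factor is replaced by the Gaussian one of the same variance.
theorem tendsto_prod_centeredChar {ι κ : Type*} {l : Filter ι} {s : ι → Finset κ}
    {p α : ι → κ → ℝ} {v : ℝ} (hp : ∀ i, ∀ k ∈ s i, p i k ∈ Set.Icc 0 1)
    (hcube : Tendsto (fun i => ∑ k ∈ s i, |α i k| ^ 3) l (𝓝 0))
    (hvar : Tendsto (fun i => ∑ k ∈ s i, p i k * (1 - p i k) * α i k ^ 2) l (𝓝 v)) :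
    Tendsto (fun i => ∏ k ∈ s i, centeredChar (p i k) (α i k)) l (𝓝 (exp (-(v / 2)) : ℝ)) := by
  have hgauss : Tendsto (fun i => ((∏ k ∈ s i,
      exp (-(p i k * (1 - p i k) * α i k ^ 2 / 2)) : ℝ) : ℂ)) l (𝓝 (exp (-(v / 2)) : ℝ)) := by
    have h := ((continuous_exp.tendsto _).comp (hvar.div_const 2).neg).ofReal
    refine h.congr fun i => ?_
    simp only [Function.comp_apply, ← exp_sum, Finset.sum_neg_distrib, Finset.sum_div]
  have hdiff : Tendsto (fun i => ∏ k ∈ s i, centeredChar (p i k) (α i k) -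
      (∏ k ∈ s i, exp (-(p i k * (1 - p i k) * α i k ^ 2 / 2)) : ℝ)) l (𝓝 0) := by
    refine squeeze_zero_norm' ?_ (by simpa using! hcube.const_mul 2)
    filter_upwards [hcube.eventually (ge_mem_nhds one_pos)] with i hi
    have hα : ∀ k ∈ s i, |α i k| ≤ 1 := fun k hk =>
      (pow_le_one_iff_of_nonneg (abs_nonneg _) three_ne_zero).1
        ((Finset.single_le_sum (f := fun k => |α i k| ^ 3) (fun _ _ => by positivity) hk).trans hi)
    rw [Complex.ofReal_prod, Finset.mul_sum]
    refine (norm_prod_sub_prod_le_sum _ _ _ (fun k hk => norm_centeredChar_le_one (hp i k hk) _)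
      fun k hk => ?_).trans
        (Finset.sum_le_sum fun k hk => norm_centeredChar_sub_gaussian_le (hp i k hk) (hα k hk))
    rw [Complex.norm_of_nonneg (exp_pos _).le, exp_le_one_iff, neg_nonpos]
    have hpk := hp i k hk
    have := mul_nonneg hpk.1 (sub_nonneg.2 hpk.2)
    positivity
  simpa using! hdiff.add hgauss

theorem tendsto_prod_bernoulliChar {ι κ : Type*} {l : Filter ι} {s : ι → Finset κ}
    {p α : ι → κ → ℝ} {c : ι → ℝ} {v : ℝ} (hp : ∀ i, ∀ k ∈ s i, p i k ∈ Set.Icc 0 1)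
    (hmean : Tendsto (fun i => ∑ k ∈ s i, p i k * α i k - c i) l (𝓝 0))
    (hcube : Tendsto (fun i => ∑ k ∈ s i, |α i k| ^ 3) l (𝓝 0))
    (hvar : Tendsto (fun i => ∑ k ∈ s i, p i k * (1 - p i k) * α i k ^ 2) l (𝓝 v)) :
    Tendsto (fun i => (∏ k ∈ s i, bernoulliChar (p i k) (α i k)) * Complex.exp (-c i * Complex.I))
      l (𝓝 (exp (-(v / 2)) : ℝ)) := by
  have hcont : Continuous fun x : ℝ => Complex.exp (x * Complex.I) := by fun_prop
  have h := ((hcont.tendsto 0).comp hmean).mul (tendsto_prod_centeredChar hp hcube hvar)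
  simp only [Complex.ofReal_zero, zero_mul, Complex.exp_zero, one_mul] at h
  refine h.congr fun i => ?_
  simp only [bernoulliChar_eq, Finset.prod_mul_distrib, ← Complex.exp_sum, Function.comp_apply]
  rw [mul_right_comm, ← Complex.exp_add, ← Finset.sum_mul, ← add_mul]
  push_cast
  rw [sub_eq_add_neg]

/-! ### Decay of the characteristic function -/

theorem cube_div_three_le_sum_sq (N : ℕ) :
    (N : ℝ) ^ 3 / 3 ≤ ∑ k ∈ Finset.Icc 1 N, (k : ℝ) ^ 2 := by
  induction N with
  | zero => simp
  | succ N ih =>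
    rw [Finset.sum_Icc_succ_top (by omega)]
    push_cast
    linear_combination ih + N.cast_nonneg (α := ℝ)

theorem two_mul_sin_half_mul_sum_cos (θ : ℝ) (N : ℕ) :
    2 * sin (θ / 2) * ∑ k ∈ Finset.Icc 1 N, cos (k * θ) = sin ((N + 1 / 2) * θ) - sin (θ / 2) := by
  induction N with
  | zero => simp; ring_nf
  | succ N ih =>
    have hlo : ((N : ℝ) + 1 / 2) * θ = (N + 1) * θ - θ / 2 := by ring
    have hhi : ((N : ℝ) + 1 + 1 / 2) * θ = (N + 1) * θ + θ / 2 := by ring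
    rw [Finset.sum_Icc_succ_top (by omega), mul_add, ih]
    push_cast
    rw [hlo, hhi, sin_sub, sin_add]
    ring

theorem le_sum_one_sub_cos_of_mul_le_pi {θ : ℝ} {N : ℕ} (h : N * |θ| ≤ π) :
    2 / (3 * π ^ 2) * θ ^ 2 * N ^ 3 ≤ ∑ k ∈ Finset.Icc 1 N, (1 - cos (k * θ)) := by
  have hcos : ∀ k ∈ Finset.Icc 1 N, 2 / π ^ 2 * θ ^ 2 * (k : ℝ) ^ 2 ≤ 1 - cos (k * θ) :=
    fun k hk => by
      have hkN : (k : ℝ) ≤ N := by exact_mod_cast (Finset.mem_Icc.1 hk).2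
      have hkθ : |k * θ| ≤ π := by
        rw [abs_mul, Nat.abs_cast]
        exact (mul_le_mul_of_nonneg_right hkN (abs_nonneg θ)).trans h
      linear_combination cos_le_one_sub_mul_cos_sq hkθ
  calc 2 / (3 * π ^ 2) * θ ^ 2 * N ^ 3 = 2 / π ^ 2 * θ ^ 2 * ((N : ℝ) ^ 3 / 3) := by ring
    _ ≤ 2 / π ^ 2 * θ ^ 2 * ∑ k ∈ Finset.Icc 1 N, (k : ℝ) ^ 2 := by
        gcongr
        exact cube_div_three_le_sum_sq N
    _ ≤ _ := by
        rw [Finset.mul_sum]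
        exact Finset.sum_le_sum hcos

theorem le_sum_one_sub_cos_of_pi_le_mul {θ : ℝ} {N : ℕ} (hθ : |θ| ≤ π) (h : π ≤ N * |θ|) :
    (N : ℝ) / 2 ≤ ∑ k ∈ Finset.Icc 1 N, (1 - cos (k * θ)) := by
  have habs (k : ℕ) : cos (k * θ) = cos (k * |θ|) := by
    rw [← cos_abs (k * θ), abs_mul, Nat.abs_cast]
  simp only [habs]
  set x := |θ|
  have hx : 0 < x := pos_of_mul_pos_right (pi_pos.trans_le h) N.cast_nonneg
  have hsin : x / π ≤ sin (x / 2) :=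
    (by ring : x / π = 2 / π * (x / 2)).trans_le (mul_le_sin (by linarith) (by linarith))
  have hNsin : 1 ≤ N * sin (x / 2) :=
    calc (1 : ℝ) ≤ N * (x / π) := by rwa [← mul_div_assoc, one_le_div₀ pi_pos]
      _ ≤ N * sin (x / 2) := by gcongr
  have hsum : sin (x / 2) * ∑ k ∈ Finset.Icc 1 N, cos (k * x) ≤ sin (x / 2) * (N / 2) := by
    linarith [two_mul_sin_half_mul_sum_cos x N, sin_le_one (((N : ℝ) + 1 / 2) * x),
      (div_pos hx pi_pos).trans_le hsin]
  have hcos := le_of_mul_le_mul_left hsum ((div_pos hx pi_pos).trans_le hsin)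
  rw [Finset.sum_sub_distrib, Finset.sum_const, Nat.card_Icc, add_tsub_cancel_right, nsmul_one]
  linarith

theorem min_le_sum_one_sub_cos {θ : ℝ} (hθ : |θ| ≤ π) (N : ℕ) :
    min (2 / (3 * π ^ 2) * θ ^ 2 * N ^ 3) ((N : ℝ) / 2) ≤
      ∑ k ∈ Finset.Icc 1 N, (1 - cos (k * θ)) :=
  (le_total (N * |θ|) π).elim
    (fun h => (min_le_left _ _).trans (le_sum_one_sub_cos_of_mul_le_pi h))
    (fun h => (min_le_right _ _).trans (le_sum_one_sub_cos_of_pi_le_mul hθ h))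

theorem norm_prod_bernoulliChar_le {ι : Type*} {s : Finset ι} {p : ι → ℝ} {c : ℝ}
    (hc : ∀ i ∈ s, c ≤ p i * (1 - p i)) (α : ι → ℝ) :
    ‖∏ i ∈ s, bernoulliChar (p i) (α i)‖ ≤ exp (-(c * ∑ i ∈ s, (1 - cos (α i)))) := by
  rw [norm_prod, Finset.mul_sum, ← Finset.sum_neg_distrib, exp_sum]
  refine Finset.prod_le_prod (fun _ _ => norm_nonneg _) fun i hi =>
    (norm_bernoulliChar_le _ _).trans (exp_le_exp.2 (neg_le_neg ?_))
  exact mul_le_mul_of_nonneg_right (hc i hi) (sub_nonneg.2 (cos_le_one _))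

theorem one_add_cube_div_six_le_exp {x : ℝ} (hx : 0 ≤ x) : 1 + x ^ 3 / 6 ≤ exp x := by
  refine le_trans ?_ (sum_le_exp_of_nonneg hx 4)
  simp only [Finset.sum_range_succ, Finset.sum_range_zero, Nat.factorial]
  norm_num
  linarith [sq_nonneg x]

-- The cubic term of `exp` absorbs `z ≤ K m³`, so that a two-regime exponential decay becomes a
-- single bound, integrable in the rescaled `θ`.
theorem one_add_min_mul_le_exp_min {a A K m z : ℝ} (hA : 0 ≤ A) (hK : 0 < K) (hm : 0 ≤ m)
    (hz : 0 ≤ z) (hzm : z ≤ K * m ^ 3) :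
    1 + min a (A ^ 3 / (6 * K)) * z ≤ exp (min (a * z) (A * m)) := by
  rcases min_cases (a * z) (A * m) with ⟨h, -⟩ | ⟨h, -⟩ <;> rw [h]
  · calc 1 + min a (A ^ 3 / (6 * K)) * z ≤ 1 + a * z := by
          gcongr
          exact min_le_left _ _
      _ ≤ exp (a * z) := by linarith [add_one_le_exp (a * z)]
  · calc 1 + min a (A ^ 3 / (6 * K)) * z ≤ 1 + A ^ 3 / (6 * K) * (K * m ^ 3) := by
          gcongr
          exact min_le_right _ _
      _ = 1 + (A * m) ^ 3 / 6 := by field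
      _ ≤ exp (A * m) := one_add_cube_div_six_le_exp (by positivity)

theorem exists_pos_le_sigmoid_mul_one_sub (b : ℝ) {t : ℝ} (ht : 0 ≤ t) :
    ∃ c > 0, ∀ u ∈ Set.Icc 0 t, c ≤ sigmoid (-(b * u)) * (1 - sigmoid (-(b * u))) := by
  have hcont : Continuous fun u : ℝ => sigmoid (-(b * u)) * (1 - sigmoid (-(b * u))) := by fun_prop
  obtain ⟨u, _, hu⟩ := isCompact_Icc.exists_isMinOn (Set.nonempty_Icc.2 ht) hcont.continuousOn
  exact ⟨_, sigmoid_mul_one_sub_pos (-(b * u)), fun v hv => hu hv⟩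

theorem div_mem_Icc_of_mem_Icc_floor {t m : ℝ} (htm : 0 ≤ t * m) (hm : 0 < m) {k : ℕ}
    (hk : k ∈ Finset.Icc 1 ⌊t * m⌋₊) : (k : ℝ) / m ∈ Set.Icc 0 t :=
  ⟨by positivity, (div_le_iff₀ hm).2 ((Nat.le_floor_iff htm).1 (Finset.mem_Icc.1 hk).2)⟩

theorem exists_norm_charProd_le (b : ℝ) {t : ℝ} (ht : 0 < t) :
    ∃ a > 0, ∀ m : ℝ, 2 ≤ t * m → ∀ θ : ℝ, |θ| ≤ π →
      ‖charProd b t m θ‖ ≤ (1 + a * (θ ^ 2 * m ^ 3))⁻¹ := by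
  obtain ⟨c, hc, hcv⟩ := exists_pos_le_sigmoid_mul_one_sub b ht.le
  refine ⟨min (c * (2 / (3 * π ^ 2)) * (t / 2) ^ 3) ((c * t / 4) ^ 3 / (6 * π ^ 2)),
    by positivity, fun m htm θ hθ => ?_⟩
  have hm : 0 < m := pos_of_mul_pos_right (two_pos.trans_le htm) ht.le
  set N := ⌊t * m⌋₊
  have hN : t * m / 2 ≤ N := by linarith [Nat.lt_floor_add_one (t * m)]
  have hθm : θ ^ 2 * m ^ 3 ≤ π ^ 2 * m ^ 3 := by
    rw [← sq_abs θ]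
    gcongr
  have hmin : min (c * (2 / (3 * π ^ 2)) * (t / 2) ^ 3 * (θ ^ 2 * m ^ 3)) (c * t / 4 * m) ≤
      c * ∑ k ∈ Finset.Icc 1 N, (1 - cos (k * θ)) :=
    calc _ = c * min (2 / (3 * π ^ 2) * θ ^ 2 * (t * m / 2) ^ 3) (t * m / 2 / 2) := by
          rw [mul_min_of_nonneg _ _ hc.le]
          congr 1 <;> ring
      _ ≤ c * min (2 / (3 * π ^ 2) * θ ^ 2 * N ^ 3) ((N : ℝ) / 2) := by gcongr
      _ ≤ _ := by
          gcongr
          exact min_le_sum_one_sub_cos hθ N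
  calc ‖charProd b t m θ‖ ≤ exp (-(c * ∑ k ∈ Finset.Icc 1 N, (1 - cos (k * θ)))) :=
        norm_prod_bernoulliChar_le
          (fun k hk => hcv _ (div_mem_Icc_of_mem_Icc_floor (by linarith) hm hk)) _
    _ = (exp (c * ∑ k ∈ Finset.Icc 1 N, (1 - cos (k * θ))))⁻¹ := exp_neg _
    _ ≤ _ := inv_anti₀ (by positivity) <|
        (one_add_min_mul_le_exp_min (by positivity) (by positivity) hm.le (by positivity)
          hθm).trans (exp_le_exp.2 hmin)

/-! ### The local limit theorem -/

theorem integral_beta {t : ℝ} (ht : √2 < t) :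
    ∫ u in (0 : ℝ)..t, u * sigmoid (-(beta t * u)) = 1 := by
  have h0 := pos_of_sqrt_two_lt ht
  rw [integral_mul_sigmoid, logisticMean_beta ht, mul_one_div_cancel (by positivity)]

theorem contDiff_sigmoid_neg_mul (b : ℝ) {n : WithTop ℕ∞} :
    ContDiff ℝ n fun u : ℝ => sigmoid (-(b * u)) :=
  (contDiff_sigmoid.of_le le_top).comp (contDiff_const.mul contDiff_id).neg

theorem tendsto_sum_sigmoid_mul_sub (b : ℝ) {t : ℝ} (ht : 0 ≤ t)
    (hb : ∫ u in (0 : ℝ)..t, u * sigmoid (-(b * u)) = 1) (y : ℝ) :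
    Tendsto (fun m : ℝ => ∑ k ∈ Finset.Icc 1 ⌊t * m⌋₊,
      sigmoid (-(b * (k / m))) * (k * (y / (m * √m))) - m ^ 2 * (y / (m * √m))) atTop (𝓝 0) := by
  have h := (tendsto_sum_sub_integral_div (contDiff_id.mul (contDiff_sigmoid_neg_mul b)) ht
    tendsto_sqrt_atTop).mul_const y
  simp only [id, hb, mul_one, zero_mul] at h
  refine h.congr' ?_
  filter_upwards [eventually_gt_atTop 0] with m hm
  rw [sub_div, sub_mul, Finset.sum_div, Finset.sum_mul]
  congr 1
  · exact Finset.sum_congr rfl fun k _ => by ring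
  · field

theorem tendsto_sum_sigmoid_mul_sq (b : ℝ) {t : ℝ} (ht : 0 ≤ t) (y : ℝ) :
    Tendsto (fun m : ℝ => ∑ k ∈ Finset.Icc 1 ⌊t * m⌋₊,
      sigmoid (-(b * (k / m))) * (1 - sigmoid (-(b * (k / m)))) * (k * (y / (m * √m))) ^ 2)
      atTop (𝓝 (t ^ 3 * logisticVariance (b * t) * y ^ 2)) := by
  have hσ := contDiff_sigmoid_neg_mul b (n := 2)
  have h := (tendsto_sum_div ((contDiff_id.pow 2).mul (hσ.mul ((contDiff_const (c := 1)).sub hσ)))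
    ht).mul_const (y ^ 2)
  simp only [id, integral_sq_mul_sigmoid] at h
  refine h.congr' ?_
  filter_upwards [eventually_gt_atTop 0] with m hm
  rw [Finset.sum_div, Finset.sum_mul]
  refine Finset.sum_congr rfl fun k _ => ?_
  rw [mul_pow (k : ℝ), div_pow y, mul_pow m, sq_sqrt hm.le]
  ring

theorem tendsto_sum_abs_cube {t : ℝ} (ht : 0 ≤ t) (y : ℝ) :
    Tendsto (fun m : ℝ => ∑ k ∈ Finset.Icc 1 ⌊t * m⌋₊, |k * (y / (m * √m))| ^ 3)
      atTop (𝓝 0) := by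
  have h := (tendsto_sum_div (contDiff_id.pow 3) ht).mul
    (tendsto_sqrt_atTop.inv_tendsto_atTop.const_mul (|y| ^ 3))
  simp only [id, mul_zero] at h
  refine h.congr' ?_
  filter_upwards [eventually_gt_atTop 0] with m hm
  rw [Finset.sum_div, Finset.sum_mul]
  refine Finset.sum_congr rfl fun k _ => ?_
  have hsq : √m ^ 3 = m * √m := by rw [pow_succ, sq_sqrt hm.le]
  rw [abs_mul, abs_div, Nat.abs_cast, abs_of_pos (by positivity : 0 < m * √m),
    mul_pow (k : ℝ), div_pow |y|, mul_pow m, hsq, Pi.inv_apply]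
  field

theorem tendsto_charProd (b : ℝ) {t : ℝ} (ht : 0 ≤ t)
    (hb : ∫ u in (0 : ℝ)..t, u * sigmoid (-(b * u)) = 1) (y : ℝ) :
    Tendsto (fun m : ℝ => charProd b t m (y / (m * √m)) *
      Complex.exp (-(m ^ 2 * (y / (m * √m)) : ℝ) * Complex.I)) atTop
      (𝓝 (exp (-(t ^ 3 * logisticVariance (b * t) * y ^ 2 / 2)) : ℝ)) :=
  tendsto_prod_bernoulliChar (fun _ _ _ => ⟨sigmoid_nonneg _, sigmoid_le_one _⟩)
    (tendsto_sum_sigmoid_mul_sub b ht hb y) (tendsto_sum_abs_cube ht y)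
    (tendsto_sum_sigmoid_mul_sq b ht y)

theorem tendsto_smul_integral_of_dominated {ι E : Type*} [NormedAddCommGroup E] [NormedSpace ℝ E]
    {l : Filter ι} [l.IsCountablyGenerated] {F : ι → ℝ → E} {G : ℝ → E} {w : ι → ℝ} {g : ℝ → ℝ}
    {a : ℝ} (ha : 0 < a) (hF : ∀ i, Continuous (F i)) (hw : Tendsto w l atTop) (hg : Integrable g)
    (hbound : ∀ᶠ i in l, ∀ y, |y| ≤ a * w i → ‖F i (y / w i)‖ ≤ g y)
    (hlim : ∀ y, Tendsto (fun i => F i (y / w i)) l (𝓝 (G y))) :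
    Tendsto (fun i => w i • ∫ θ in -a..a, F i θ) l (𝓝 (∫ y, G y)) := by
  have hscale : ∀ᶠ i in l, ∫ y, (Set.Ioc (-(a * w i)) (a * w i)).indicator
      (fun y => F i (y / w i)) y = w i • ∫ θ in -a..a, F i θ := by
    filter_upwards [hw.eventually_gt_atTop 0] with i hi
    rw [MeasureTheory.integral_indicator measurableSet_Ioc,
      ← integral_of_le (neg_le_self (by positivity)), intervalIntegral.integral_comp_div _ hi.ne',
      neg_div, mul_div_cancel_right₀ _ hi.ne']
  refine Tendsto.congr' hscale ?_
  refine tendsto_integral_filter_of_dominated_convergence (fun y => |g y|)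
    (Eventually.of_forall fun i => ?_) ?_ hg.abs (ae_of_all _ fun y => ?_)
  · exact ((hF i).comp (continuous_id.div_const _)).aestronglyMeasurable.indicator
      measurableSet_Ioc
  · filter_upwards [hbound] with i hi
    refine ae_of_all _ fun y => ?_
    rw [norm_indicator_eq_indicator_norm]
    exact Set.indicator_apply_le'
      (fun hy => (hi y (abs_le.2 ⟨hy.1.le, hy.2⟩)).trans (le_abs_self _)) fun _ => abs_nonneg _
  · refine (hlim y).congr' ?_
    filter_upwards [(hw.const_mul_atTop ha).eventually_gt_atTop |y|] with i hi
    have hy : y ∈ Set.Ioc (-(a * w i)) (a * w i) := ⟨(abs_lt.1 hi).1, (abs_lt.1 hi).2.le⟩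
    rw [Set.indicator_of_mem hy]

theorem continuous_charProd (b t m : ℝ) : Continuous (charProd b t m) := by
  unfold charProd bernoulliChar
  fun_prop

theorem integrable_inv_one_add_mul_sq {a : ℝ} (ha : 0 < a) :
    Integrable fun y : ℝ => (1 + a * y ^ 2)⁻¹ := by
  have := integrable_inv_one_add_sq.comp_mul_left' (sqrt_pos.2 ha).ne'
  simpa only [mul_pow, sq_sqrt ha.le] using this

theorem integral_ofReal_exp_neg_mul_sq_div_two (v : ℝ) :
    ∫ y : ℝ, ((exp (-(v * y ^ 2 / 2)) : ℝ) : ℂ) = (√(2 * π / v) : ℝ) := by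
  have h := integral_gaussian (v / 2)
  rw [div_div_eq_mul_div, mul_comm π] at h
  rw [integral_complex_ofReal, ← h]
  congr! 4
  ring

theorem tendsto_integral_charProd (b : ℝ) {t : ℝ} (ht : 0 < t)
    (hb : ∫ u in (0 : ℝ)..t, u * sigmoid (-(b * u)) = 1) :
    Tendsto (fun m : ℝ => (m * √m) •
      ∫ θ in -π..π, charProd b t m θ * Complex.exp (-(m ^ 2 * θ : ℝ) * Complex.I)) atTop
      (𝓝 (√(2 * π / (t ^ 3 * logisticVariance (b * t))) : ℝ)) := by
  obtain ⟨a, ha, hdecay⟩ := exists_norm_charProd_le b ht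
  rw [← integral_ofReal_exp_neg_mul_sq_div_two]
  refine tendsto_smul_integral_of_dominated pi_pos (fun m => ?_)
    (tendsto_id.atTop_mul_atTop₀ tendsto_sqrt_atTop) (integrable_inv_one_add_mul_sq ha) ?_
    (tendsto_charProd b ht.le hb)
  · have := continuous_charProd b t m
    fun_prop
  · filter_upwards [eventually_gt_atTop 0, eventually_ge_atTop (2 / t)] with m hm htm y hy
    have hw : 0 < m * √m := by positivity
    have hθ : |y / (m * √m)| ≤ π := by rwa [abs_div, abs_of_pos hw, div_le_iff₀ hw]
    have hsq : (y / (m * √m)) ^ 2 * m ^ 3 = y ^ 2 := by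
      rw [div_pow, mul_pow, sq_sqrt hm.le]
      field
    rw [norm_mul, ← Complex.ofReal_neg, Complex.norm_exp_ofReal_mul_I, mul_one]
    exact (hdecay m ((div_le_iff₀' ht).1 htm) _ hθ).trans_eq (by rw [hsq])

/-! ### The asymptotic formula -/

theorem contDiff_log_one_add_exp (b : ℝ) {n : WithTop ℕ∞} :
    ContDiff ℝ n fun u : ℝ => log (1 + exp (-(b * u))) :=
  (contDiff_const.add (contDiff_const.mul contDiff_id).neg.exp).log fun u => by positivity

theorem integral_log_one_add_exp (b t : ℝ) :
    ∫ u in (0 : ℝ)..t, log (1 + exp (-(b * u))) =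
      t * log (1 + exp (-(b * t))) + b * ∫ u in (0 : ℝ)..t, u * sigmoid (-(b * u)) := by
  have hderiv : ∀ u ∈ Set.uIcc (0 : ℝ) t, HasDerivAt (fun u : ℝ => u * log (1 + exp (-(b * u))))
      (log (1 + exp (-(b * u))) - b * (u * sigmoid (-(b * u)))) u := fun u _ => by
    have hlin : HasDerivAt (fun u : ℝ => -(b * u)) (-(b * 1)) u :=
      ((hasDerivAt_id u).const_mul b).neg
    convert! (hasDerivAt_id u).mul ((hlin.exp.const_add 1).log (by positivity)) using 1
    rw [← exp_div_one_add_exp, id]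
    ring
  have hlog := (contDiff_log_one_add_exp b (n := 0)).continuous.intervalIntegrable
    (μ := volume) 0 t
  have hmean := (intervalIntegrable_mul_sigmoid b 0 t).const_mul b
  have h := integral_eq_sub_of_hasDerivAt hderiv (hlog.sub hmean)
  rw [intervalIntegral.integral_sub hlog hmean, intervalIntegral.integral_const_mul, zero_mul,
    sub_zero] at h
  exact sub_eq_iff_eq_add.1 h

theorem partitionProd_eq_exp_sum (b t m : ℝ) :
    partitionProd b t m =
      exp (∑ k ∈ Finset.Icc 1 ⌊t * m⌋₊, log (1 + exp (-(b * (k / m))))) := by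
  rw [exp_sum]
  exact Finset.prod_congr rfl fun k _ => (exp_log (by positivity)).symm

theorem isEquivalent_partitionProd (b : ℝ) {t : ℝ} (ht : 0 ≤ t) :
    Asymptotics.IsEquivalent atTop (partitionProd b t) fun m =>
      √((1 + exp (-(b * t))) / 2) / (1 + exp (-(b * t))) ^ Int.fract (t * m) *
        exp ((∫ u in (0 : ℝ)..t, log (1 + exp (-(b * u)))) * m) := by
  have h := (continuous_exp.tendsto _).comp
    (tendsto_sum_sub_integral (contDiff_log_one_add_exp b) ht)
  rw [exp_zero] at h
  refine Asymptotics.isEquivalent_of_tendsto_one (h.congr fun m => ?_)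
  have hsqrt : √((1 + exp (-(b * t))) / 2) = exp ((log (1 + exp (-(b * t))) - log 2) / 2) := by
    rw [← log_div (by positivity) two_ne_zero, exp_half, exp_log (by positivity)]
  rw [Pi.div_apply, partitionProd_eq_exp_sum, hsqrt, rpow_def_of_pos (by positivity), ← exp_sub,
    ← exp_add, ← exp_sub, Function.comp]
  congr 1
  norm_num
  ring

theorem sqrt_mul_sqrt_sqrt {x : ℝ} (hx : 0 ≤ x) : √x * √√x = x ^ (3 / 4 : ℝ) := by
  rw [sqrt_eq_rpow, sqrt_eq_rpow, ← rpow_mul hx, ← rpow_add_of_nonneg hx] <;> norm_num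

theorem isEquivalent_distinctCount_partitionProd (b : ℝ) {t : ℝ} (ht : 0 < t)
    (hb : ∫ u in (0 : ℝ)..t, u * sigmoid (-(b * u)) = 1) :
    Asymptotics.IsEquivalent atTop (fun n : ℕ => (distinctCount t n : ℝ)) fun n =>
      √(2 * π / (t ^ 3 * logisticVariance (b * t))) / (2 * π) / (n : ℝ) ^ (3 / 4 : ℝ) *
        exp (b * √(n : ℝ)) * partitionProd b t √(n : ℝ) := by
  have hV := logisticVariance_pos (b * t)
  have hL : √(2 * π / (t ^ 3 * logisticVariance (b * t))) ≠ 0 := by positivity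
  have hint := (Complex.continuous_re.tendsto _).comp ((tendsto_integral_charProd b ht hb).comp
    (tendsto_sqrt_atTop.comp tendsto_natCast_atTop_atTop))
  rw [Complex.ofReal_re, ← Asymptotics.isEquivalent_const_iff_tendsto hL] at hint
  have h := hint.mul (Asymptotics.IsEquivalent.refl (u := fun n : ℕ =>
    exp (b * √(n : ℝ)) * partitionProd b t √(n : ℝ) / (2 * π * (n : ℝ) ^ (3 / 4 : ℝ))))
  refine (h.congr_left ?_).congr_right (Eventually.of_forall fun n => ?_)
  · filter_upwards [eventually_ne_atTop 0] with n hn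
    have hpow : (n : ℝ) ^ (3 / 4 : ℝ) ≠ 0 := by positivity
    simp only [Pi.mul_apply, Function.comp_apply, Complex.smul_re, smul_eq_mul,
      sq_sqrt n.cast_nonneg, sqrt_mul_sqrt_sqrt n.cast_nonneg]
    rw [distinctCount_eq_re_integral ht.le b hn]
    push_cast
    field
  · simp only [Pi.mul_apply, Function.const_apply]
    field

theorem cosh_mul_sqrt_deriv_beta {t : ℝ} (ht : √2 < t) :
    cosh (beta t * t / 2) * √(deriv beta t / (π * t)) =
      √(2 * π / (t ^ 3 * logisticVariance (beta t * t))) / (2 * π) *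
        √((1 + exp (-(beta t * t))) / 2) := by
  have h0 := pos_of_sqrt_two_lt ht
  rw [deriv_beta ht, cosh_eq]
  set c := beta t * t
  have hV := logisticVariance_pos c
  have hσ := sigmoid_pos (-c)
  have hexp : exp (-c) = (exp (c / 2) ^ 2)⁻¹ := by
    rw [← exp_nat_mul, ← exp_neg]
    push_cast
    ring_nf
  rw [← sq_eq_sq₀ (by positivity) (by positivity), mul_pow, mul_pow, div_pow √_,
    sq_sqrt (by positivity), sq_sqrt (by positivity), sq_sqrt (by positivity),
    ← exp_div_one_add_exp, hexp, exp_neg (c / 2)]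
  field

theorem isEquivalent_distinctCount {t : ℝ} (ht : √2 < t) :
    Asymptotics.IsEquivalent atTop (fun n : ℕ => (distinctCount t n : ℝ)) fun n =>
      Afun n t / (n : ℝ) ^ (3 / 4 : ℝ) * exp (Bfun t * √(n : ℝ)) := by
  have h0 := pos_of_sqrt_two_lt ht
  have hprod := (isEquivalent_partitionProd (beta t) h0.le).comp_tendsto
    (tendsto_sqrt_atTop.comp tendsto_natCast_atTop_atTop)
  refine ((isEquivalent_distinctCount_partitionProd (beta t) h0 (integral_beta ht)).trans
    (Asymptotics.IsEquivalent.refl.mul hprod)).congr_right (Eventually.of_forall fun n => ?_)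
  have hA : Afun n t = √(2 * π / (t ^ 3 * logisticVariance (beta t * t))) / (2 * π) *
      (√((1 + exp (-(beta t * t))) / 2) /
        (1 + exp (-(beta t * t))) ^ Int.fract (t * √(n : ℝ))) := by
    rw [mul_div_assoc', ← cosh_mul_sqrt_deriv_beta ht, Afun, cosh_eq, neg_mul]
    ring
  have hB : exp (Bfun t * √(n : ℝ)) = exp (beta t * √(n : ℝ)) *
      exp ((∫ u in (0 : ℝ)..t, log (1 + exp (-(beta t * u)))) * √(n : ℝ)) := by
    rw [integral_log_one_add_exp, integral_beta ht, ← exp_add, Bfun, neg_mul]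
    ring_nf
  simp only [Pi.mul_apply, Function.comp_apply]
  rw [hA, hB]
  ring

end DistinctPartitions

theorem theorem1 (t : ℝ) (ht : √2 < t) :
    -- `β` is well defined on `(√2, ∞)`, with values in `(-∞, π / (2√3))`
    (∀ s : ℝ, √2 < s →
      IsBeta s (beta s) ∧ (∀ b : ℝ, IsBeta s b → b = beta s) ∧
        beta s < Real.pi / (2 * √3)) ∧
    -- `β'(t)` exists and is positive, so that `A_n(t)` is meaningful
    DifferentiableAt ℝ beta t ∧ 0 < deriv beta t ∧
    -- the asymptotic formula
    Asymptotics.IsEquivalent Filter.atTop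
      (fun n : ℕ => (distinctCount t n : ℝ))
      (fun n : ℕ => Afun n t / (n : ℝ) ^ (3 / 4 : ℝ) * Real.exp (Bfun t * √(n : ℝ))) := by
  exact ⟨fun _ hs => ⟨isBeta_beta hs, fun _ => eq_beta_of_isBeta hs, beta_lt hs⟩,
    (hasDerivAt_beta ht).differentiableAt, deriv_beta_pos ht, isEquivalent_distinctCount ht⟩
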